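/- Boolean formulas are built from propositional variables $p_0,p_1,\dots$ and the constants $0,1$ by the gates $\neg,\wedge,\vee$; we write $A\oplus B$ for $(A\wedge\neg B)\vee(\neg A\wedge B)$. The size of a Boolean formula is its number of symbols (gates and leaves). A Frege rule is a finite list of premises $A_1,\dots,A_k$ ($k\ge 0$) together with a conclusion $A_0$, all Boolean formulas; it is sound if every assignment satisfying all premises satisfies the conclusion. A Frege proof using a set $P$ of Frege rules, from a set $T$ of additional axioms, is a finite sequence of Boolean formulas in which each line is in $T$ or is obtained from earlier lines by a substitution instance of a rule of $P$; it is a proof of its last line, and its size is the sum of the sizes of its lines. A Frege proof system is a finite set $P$ of sound Frege rules that is implicationally complete: whenever a set $T$ of Boolean formulas semantically implies $A$, there is a proof of $A$ from $T$ using $P$. A non-commutative formula $F$ over $GF(2)$ is an ordered binary tree whose leaves are labelled by variables $x_0,x_1,\dots$ or by elements of $GF(2)$ and whose inner nodes are labelled $+$ or $\times$. It computes a polynomial in the free algebra $GF(2)\langle x_0,x_1,\dots\rangle$, the product taken in the order of the children. Its size is its number of nodes and its depth is the maximal length of a path from the root to a leaf. The Boolean formula $F_{bool}$ is obtained from $F$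 by replacing $+$ by $\oplus$, $\times$ by $\wedge$, and each $x_i$ by $p_i$. **Lemma.** For every Frege proof system $P$ and every real number $a$ there is a real constant $C$ such that the following holds. Let $s\ge 2$ be an integer and let $F$ be a non-commutative formula over $GF(2)$ of size at most $s$ and depth at most $a\log_2 s$ that computes the zero polynomial. Then $\neg F_{bool}$ has a Frege proof in $P$, without additional axioms, of size at most $s^{C\log_2 s}$. -/

import Mathlib

/-- Boolean formulas over the variables `p₀, p₁, …`: trees with gates `¬`, `∧`, `∨` and leaves
labelled with variables or with the constants `0` (`false`) and `1` (`true`). -/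
inductive BoolFormula : Type
  | var (i : ℕ) : BoolFormula
  | const (b : Bool) : BoolFormula
  | neg (A : BoolFormula) : BoolFormula
  | and (A B : BoolFormula) : BoolFormula
  | or (A B : BoolFormula) : BoolFormula

namespace BoolFormula

/-- Truth value of a formula under an assignment. -/
def eval (v : ℕ → Bool) : BoolFormula → Bool
  | var i => v i
  | const b => b
  | neg A => !(eval v A)
  | and A B => eval v A && eval v B
  | or A B => eval v A || eval v B

/-- Simultaneous substitution of the formula `σ i` for every variable `pᵢ`. -/
def subst (σ : ℕ → BoolFormula) : BoolFormula → BoolFormula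
  | var i => σ i
  | const b => const b
  | neg A => neg (subst σ A)
  | and A B => and (subst σ A) (subst σ B)
  | or A B => or (subst σ A) (subst σ B)

/-- Number of symbols (gates and leaves) of a formula. It is at least the number of gates. -/
def size : BoolFormula → ℕ
  | var _ => 1
  | const _ => 1
  | neg A => size A + 1
  | and A B => size A + size B + 1
  | or A B => size A + size B + 1

/-- `A ⊕ B`, written with the gates of the language: `(A ∧ ¬B) ∨ (¬A ∧ B)`. -/
def xor (A B : BoolFormula) : BoolFormula :=
  or (and A (neg B)) (and (neg A) B)

end BoolFormula

/-- A Frege rule `A₁, …, A_k / A₀`; for `k = 0` it is an axiom scheme. -/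
structure FregeRule : Type where
  /-- The upper formulas `A₁, …, A_k`. -/
  premises : List BoolFormula
  /-- The lower formula `A₀`. -/
  conclusion : BoolFormula

/-- Every assignment satisfying all premises satisfies the conclusion. -/
def FregeRule.Sound (R : FregeRule) : Prop :=
  ∀ v : ℕ → Bool, (∀ A ∈ R.premises, A.eval v = true) → R.conclusion.eval v = true

/-- `IsFregeDerivation P T π`: the sequence of lines `π` (first line first) is a derivation with
the rules `P` from the additional axioms `T`: each line belongs to `T` or results from earlier
lines by a substitution instance of a rule in `P`. -/
inductive IsFregeDerivation (P : Set FregeRule) (T : Set BoolFormula) : List BoolFormula → Prop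
  | nil : IsFregeDerivation P T []
  | hyp {π : List BoolFormula} {A : BoolFormula} :
      IsFregeDerivation P T π → A ∈ T → IsFregeDerivation P T (π ++ [A])
  | rule {π : List BoolFormula} {R : FregeRule} (σ : ℕ → BoolFormula) :
      IsFregeDerivation P T π → R ∈ P → (∀ A ∈ R.premises, A.subst σ ∈ π) →
        IsFregeDerivation P T (π ++ [R.conclusion.subst σ])

/-- `π` is a derivation whose last line is `A`. -/
def IsFregeProofOf (P : Set FregeRule) (T : Set BoolFormula) (π : List BoolFormula)
    (A : BoolFormula) : Prop :=
  IsFregeDerivation P T π ∧ π.getLast? = some A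

/-- Size of a proof: the total size of its lines. -/
def fregeProofSize (π : List BoolFormula) : ℕ :=
  (π.map BoolFormula.size).sum

/-- Whenever a set of formulas `T` semantically implies `A`, there is a proof of `A` from `T`. -/
def ImplicationallyComplete (P : Set FregeRule) : Prop :=
  ∀ (T : Set BoolFormula) (A : BoolFormula),
    (∀ v : ℕ → Bool, (∀ B ∈ T, B.eval v = true) → A.eval v = true) →
      ∃ π : List BoolFormula, IsFregeProofOf P T π A

/-- A Frege proof system: a finite set of sound Frege rules that is implicationally complete. -/
structure IsFregeSystem (P : Set FregeRule) : Prop where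
  finite : P.Finite
  sound : ∀ R ∈ P, R.Sound
  complete : ImplicationallyComplete P

/-- Non-commutative arithmetic formulas over `K` in the variables `x₀, x₁, …`: ordered binary trees
with plus and product gates and leaves labelled with variables or elements of `K`. -/
inductive NCFormula (K : Type) : Type
  | var (i : ℕ) : NCFormula K
  | const (c : K) : NCFormula K
  | add (F G : NCFormula K) : NCFormula K
  | mul (F G : NCFormula K) : NCFormula K

namespace NCFormula

/-- The non-commutative polynomial computed by a formula. -/
noncomputable def poly {K : Type} [Field K] : NCFormula K → FreeAlgebra K ℕ
  | var i => FreeAlgebra.ι K i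
  | const c => algebraMap K (FreeAlgebra K ℕ) c
  | add F G => poly F + poly G
  | mul F G => poly F * poly G

/-- Number of nodes of the tree. -/
def size {K : Type} : NCFormula K → ℕ
  | var _ => 1
  | const _ => 1
  | add F G => size F + size G + 1
  | mul F G => size F + size G + 1

/-- Maximal length of a path from the root to a leaf. -/
def depth {K : Type} : NCFormula K → ℕ
  | var _ => 0
  | const _ => 0
  | add F G => max (depth F) (depth G) + 1
  | mul F G => max (depth F) (depth G) + 1

/-- The Boolean formula `F_bool` of a formula `F` over GF(2): plus gates become `⊕`, product gates
become `∧`, the variable `xᵢ` becomes `pᵢ`. -/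
def toBool : NCFormula (ZMod 2) → BoolFormula
  | var i => BoolFormula.var i
  | const c => BoolFormula.const (decide (c = 1))
  | add F G => BoolFormula.xor (toBool F) (toBool G)
  | mul F G => BoolFormula.and (toBool F) (toBool G)

end NCFormula

/-! Each leaf l of `F` carrying a variable x_l has a right residual R_l, the product of the right
factors met on the way to the root. Splitting off first letters gives F = c + ∑ v_l x_l R_l. Every
combination ∑ u_l R_l expands in the same way, as a constant plus ∑ u'_l x_l R_l over the same
residuals. In a free algebra the zero polynomial has zero constant term and zero left quotient by
every x_j. So a relation ∑ u_l R_l = 0 yields, for each j, the relation whose weights are u'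
restricted to the leaves labelled j (`poly_residualSum_nextWeight`). Since R_l is built from leaves
strictly to the right of l, u' is supported further right than u (`VanishesBelow.nextWeight`).

There may be exponentially many relations, so only an echelon spanning sequence w_0, w_1, … of them
is refuted (`exists_echelon`), from the last one down. To refute the sum with weights w_k, expand
it, group the terms by first variable, and factor each variable out. The cofactors are relations
vanishing below k + 1, hence sums of some w_i with i > k, which are already refuted. The same
reduction takes `F` itself to the w_i.

All the identities involved are proved by induction along `F`, with a bounded number of small sound
rules per node plus auxiliary linearity identities. Residual sums have a shape that does not depend
on the weights and size O(16^depth), which is polynomial in s because the depth is logarithmic. The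
whole proof is therefore of polynomial size, which is within the required bound. -/

namespace BoolFormula

/-! ### Size, substitution and finiteness for Boolean formulas -/

theorem one_le_size (A : BoolFormula) : 1 ≤ A.size := by
  cases A <;> simp [size]

theorem subst_subst (σ τ : ℕ → BoolFormula) (A : BoolFormula) :
    (A.subst τ).subst σ = A.subst fun i => (τ i).subst σ := by
  induction A <;> simp_all [subst]

theorem size_subst_le {σ : ℕ → BoolFormula} {M : ℕ} (hM : ∀ i, (σ i).size ≤ M)
    (A : BoolFormula) : (A.subst σ).size ≤ A.size * M := by
  have h1 : 1 ≤ M := (one_le_size _).trans (hM 0)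
  induction A <;> simp only [subst, size, add_mul, one_mul] <;> first | exact hM _ | omega

/-- `A ↔ B`, written with the gates of the language. -/
def iff (A B : BoolFormula) : BoolFormula :=
  neg (xor A B)

@[simp]
theorem eval_xor (v : ℕ → Bool) (A B : BoolFormula) :
    (xor A B).eval v = (A.eval v ^^ B.eval v) := by
  simp only [xor, eval]
  cases A.eval v <;> cases B.eval v <;> rfl

@[simp]
theorem eval_iff (v : ℕ → Bool) (A B : BoolFormula) :
    (iff A B).eval v = (A.eval v == B.eval v) := by
  simp only [iff, eval, eval_xor]
  cases A.eval v <;> cases B.eval v <;> rfl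

/-- All variables of the formula have index less than `n`. -/
def VarsBelow (n : ℕ) : BoolFormula → Prop
  | var i => i < n
  | const _ => True
  | neg A => VarsBelow n A
  | and A B => VarsBelow n A ∧ VarsBelow n B
  | or A B => VarsBelow n A ∧ VarsBelow n B

theorem finite_setOf_size_le (n m : ℕ) :
    {A : BoolFormula | A.size ≤ n ∧ A.VarsBelow m}.Finite := by
  induction n with
  | zero =>
    refine Set.finite_empty.subset fun A hA => ?_
    have := one_le_size A
    have := hA.1
    omega
  | succ n ih =>
    refine ((((Set.finite_Iio m).image var).union ((Set.finite_univ (α := Bool)).image const)).union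
      (ih.image neg)).union ((ih.image2 and ih).union (ih.image2 or ih)) |>.subset fun A hA => ?_
    obtain ⟨h1, h2⟩ := hA
    cases A with
    | var i => exact .inl (.inl (.inl ⟨i, h2, rfl⟩))
    | const b => exact .inl (.inl (.inr ⟨b, trivial, rfl⟩))
    | neg A => exact .inl (.inr ⟨A, ⟨Nat.le_of_succ_le_succ h1, h2⟩, rfl⟩)
    | and A B =>
      simp only [size] at h1
      exact .inr (.inl ⟨A, ⟨by omega, h2.1⟩, B, ⟨by omega, h2.2⟩, rfl⟩)
    | or A B =>
      simp only [size] at h1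
      exact .inr (.inr ⟨A, ⟨by omega, h2.1⟩, B, ⟨by omega, h2.2⟩, rfl⟩)

end BoolFormula

theorem List.finite_setOf_length_le_of_mem {α : Type*} {S : Set α} (hS : S.Finite) (k : ℕ) :
    {l : List α | l.length ≤ k ∧ ∀ a ∈ l, a ∈ S}.Finite := by
  induction k with
  | zero =>
    refine (Set.finite_singleton []).subset fun l hl => ?_
    simpa using hl.1
  | succ k ih =>
    refine ((Set.finite_singleton []).union (hS.image2 List.cons ih)).subset fun l hl => ?_
    cases l with
    | nil => exact .inl rfl
    | cons a l =>
      obtain ⟨h1, h2⟩ := hl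
      exact .inr ⟨a, h2 a (by simp), l, ⟨by simpa using h1, fun b hb => h2 b (by simp [hb])⟩, rfl⟩

/-! ### Extending derivations at a bounded cost -/

/-- `A` is a line that can be added, together with auxiliary lines, to every derivation that
contains all lines in `Γ`, at a cost of at most `n` symbols. -/
def FregeEntails (P : Set FregeRule) (Γ : Set BoolFormula) (A : BoolFormula) (n : ℕ) : Prop :=
  ∀ π, IsFregeDerivation P ∅ π → (∀ B ∈ Γ, B ∈ π) →
    ∃ ρ, IsFregeDerivation P ∅ (π ++ ρ) ∧ A ∈ π ++ ρ ∧ fregeProofSize ρ ≤ n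

namespace FregeEntails

variable {P : Set FregeRule} {Γ Δ : Set BoolFormula} {A B : BoolFormula}
  {n m : ℕ}

theorem mono (h : FregeEntails P Γ A n) (hΓ : Γ ⊆ Δ) (hn : n ≤ m) : FregeEntails P Δ A m := by
  intro π hπ hΔ
  obtain ⟨ρ, h1, h2, h3⟩ := h π hπ fun B hB => hΔ B (hΓ hB)
  exact ⟨ρ, h1, h2, h3.trans hn⟩

theorem mono_right (h : FregeEntails P Γ A n) (hn : n ≤ m) : FregeEntails P Γ A m :=
  h.mono subset_rfl hn

theorem of_mem (h : A ∈ Γ) : FregeEntails P Γ A 0 := fun π hπ hΓ =>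
  ⟨[], by simpa using hπ, by simpa using hΓ A h, by simp [fregeProofSize]⟩

theorem cut (h : FregeEntails P Γ A n) (h' : FregeEntails P (insert A Γ) B m) :
    FregeEntails P Γ B (n + m) := by
  intro π hπ hΓ
  obtain ⟨ρ, h1, h2, h3⟩ := h π hπ hΓ
  obtain ⟨τ, h4, h5, h6⟩ := h' (π ++ ρ) h1 (by
    rintro C (rfl | hC)
    · exact h2
    · exact List.mem_append_left _ (hΓ C hC))
  refine ⟨ρ ++ τ, by simpa using h4, by simpa using h5, ?_⟩
  simp only [fregeProofSize, List.map_append, List.sum_append] at *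
  omega

theorem cut_list (Hs : List (BoolFormula × ℕ)) (h : ∀ H ∈ Hs, FregeEntails P Γ H.1 H.2)
    (h' : FregeEntails P {A | A ∈ Hs.map Prod.fst} B m) :
    FregeEntails P Γ B ((Hs.map Prod.snd).sum + m) := by
  -- Keeping `Γ` among the hypotheses lets the induction cut away one formula of the list at a time.
  suffices FregeEntails P (Γ ∪ {A | A ∈ Hs.map Prod.fst}) B m by
    clear h'
    induction Hs generalizing m with
    | nil => simpa using this
    | cons H Hs ih =>
      have := ih (m := H.2 + m) (fun H' h' => h H' (by simp [h'])) <|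
        ((h H (by simp)).mono Set.subset_union_left le_rfl).cut <| this.mono ?_ le_rfl
      · exact this.mono_right (by simp; omega)
      · intro A hA
        simp only [List.map_cons, List.mem_cons, Set.mem_union, Set.mem_ofPred_eq,
          Set.mem_insert_iff] at hA ⊢
        tauto
  exact h'.mono Set.subset_union_right le_rfl

theorem exists_proof (h : FregeEntails P ∅ A n) :
    ∃ π, IsFregeProofOf P ∅ π A ∧ fregeProofSize π ≤ n + A.size := by
  obtain ⟨ρ, h1, h2, h3⟩ := h [] .nil (by simp)
  rw [List.nil_append] at h1 h2
  -- A proof must end in `A`, which may occur in the middle of the derivation. Without additional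
  -- axioms every line is a rule instance, so it can be repeated at the end; this costs the extra
  -- `A.size`.
  have key : ∀ π, IsFregeDerivation P ∅ π → A ∈ π → IsFregeDerivation P ∅ (π ++ [A]) := by
    suffices ∀ π, IsFregeDerivation P ∅ π → A ∈ π →
        ∃ R ∈ P, ∃ σ, (∀ B ∈ R.premises, B.subst σ ∈ π) ∧ A = R.conclusion.subst σ by
      intro π hπ hA
      obtain ⟨R, hR, σ, hB, rfl⟩ := this π hπ hA
      exact .rule σ hπ hR hB
    intro π hπ
    induction hπ with
    | nil => simp
    | hyp _ h => exact h.elim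
    | @rule π R σ hπ hR hB ih =>
      intro hA
      rcases List.mem_append.1 hA with hA | hA
      · obtain ⟨R', hR', σ', hB', h'⟩ := ih hA
        exact ⟨R', hR', σ', fun B hB => List.mem_append_left _ (hB' B hB), h'⟩
      · exact ⟨R, hR, σ, fun B h => List.mem_append_left _ (hB B h), by simpa using hA⟩
  refine ⟨ρ ++ [A], ⟨key ρ h1 h2, by simp⟩, ?_⟩
  simp only [fregeProofSize, List.map_append, List.sum_append, List.map_cons, List.map_nil,
    List.sum_singleton] at *
  omega

/-- Derivations are stable under substitution, because instances of instances are instances. The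
substituted axioms are already lines of `π'` and cost nothing. -/
theorem of_derivation {T : Set BoolFormula} {π : List BoolFormula} {σ : ℕ → BoolFormula}
    (h : IsFregeDerivation P T π) (hT : ∀ B ∈ T, B.subst σ ∈ Γ) :
    ∀ π', IsFregeDerivation P ∅ π' → (∀ B ∈ Γ, B ∈ π') →
      ∃ ρ, IsFregeDerivation P ∅ (π' ++ ρ) ∧ (∀ A ∈ π, A.subst σ ∈ π' ++ ρ) ∧
        fregeProofSize ρ ≤ fregeProofSize (π.map (·.subst σ)) := by
  intro π' hπ' hΓ
  induction h with
  | nil => exact ⟨[], by simpa using hπ', by simp, by simp⟩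
  | @hyp π A _ hA ih =>
    obtain ⟨ρ, h1, h2, h3⟩ := ih
    refine ⟨ρ, h1, ?_, h3.trans (by simp [fregeProofSize])⟩
    intro B hB
    rcases List.mem_append.1 hB with hB | hB
    · exact h2 B hB
    · rw [List.mem_singleton.1 hB]
      exact List.mem_append_left _ (hΓ _ (hT A hA))
  | @rule π R τ _ hR hB ih =>
    obtain ⟨ρ, h1, h2, h3⟩ := ih
    have := IsFregeDerivation.rule (fun i => (τ i).subst σ) h1 hR fun A hA => by
      rw [← BoolFormula.subst_subst]
      exact h2 _ (hB A hA)
    refine ⟨ρ ++ [(R.conclusion.subst τ).subst σ], ?_, ?_, ?_⟩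
    · rw [BoolFormula.subst_subst, ← List.append_assoc]
      exact this
    · intro B hB
      rw [← List.append_assoc]
      rcases List.mem_append.1 hB with hB | hB
      · exact List.mem_append_left _ (h2 B hB)
      · rw [List.mem_singleton.1 hB]
        simp
    · simp only [fregeProofSize, List.map_append, List.sum_append, List.map_cons, List.map_nil,
        List.sum_singleton] at *
      omega

end FregeEntails

/-! ### Uniform simulation of small sound rules -/

/-- A bound on the complexity of a rule that leaves only finitely many rules. -/
def FregeRule.Small (R : FregeRule) : Prop :=
  R.premises.length ≤ 5 ∧ (∀ A ∈ R.premises, A.size ≤ 1000 ∧ A.VarsBelow 10) ∧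
    R.conclusion.size ≤ 1000 ∧ R.conclusion.VarsBelow 10

theorem FregeRule.finite_setOf_small : {R : FregeRule | R.Small}.Finite := by
  have hS := BoolFormula.finite_setOf_size_le 1000 10
  refine ((List.finite_setOf_length_le_of_mem hS 5).image2 FregeRule.mk hS).subset fun R hR => ?_
  exact ⟨R.premises, ⟨hR.1, hR.2.1⟩, R.conclusion, hR.2.2, rfl⟩

/-- Every instance of a small sound rule by formulas of size at most `M` can be simulated by `P` at
a cost of at most `U` symbols. -/
def IsUnitCost (P : Set FregeRule) (M U : ℕ) : Prop :=
  1 ≤ M ∧ ∀ R : FregeRule, R.Small → R.Sound → ∀ σ : ℕ → BoolFormula, (∀ i, (σ i).size ≤ M) →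
    FregeEntails P {A | A ∈ R.premises.map (·.subst σ)} (R.conclusion.subst σ) U

/-- Completeness gives one derivation of the conclusion from the premises taken as axioms. Its
substitution instances simulate all instances of the rule, and their size grows at most linearly in
`M`. -/
theorem FregeRule.Sound.exists_entails {P : Set FregeRule} (hP : ImplicationallyComplete P)
    {R : FregeRule} (hR : R.Sound) :
    ∃ c, ∀ (M : ℕ) (σ : ℕ → BoolFormula), (∀ i, (σ i).size ≤ M) →
      FregeEntails P {A | A ∈ R.premises.map (·.subst σ)} (R.conclusion.subst σ) (c * M) := by
  obtain ⟨π, h1, h2⟩ := hP {A | A ∈ R.premises} R.conclusion hR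
  refine ⟨fregeProofSize π, fun M σ hσ π' h3 h4 => ?_⟩
  obtain ⟨ρ, h5, h6, h7⟩ := FregeEntails.of_derivation (σ := σ) h1
    (fun B hB => List.mem_map_of_mem (f := (·.subst σ)) hB) π' h3 h4
  refine ⟨ρ, h5, h6 _ (List.mem_of_getLast? h2), h7.trans ?_⟩
  clear * - hσ
  induction π with
  | nil => simp [fregeProofSize]
  | cons A π ih =>
    have := BoolFormula.size_subst_le hσ A
    simp only [fregeProofSize, List.map_cons, List.sum_cons, add_mul] at *
    omega

/-- There are finitely many small rules, so a single constant serves them all. The numerical limits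
in `FregeRule.Small` only have to cover the rules used below. -/
theorem exists_isUnitCost {P : Set FregeRule} (hP : ImplicationallyComplete P) :
    ∃ c, ∀ M, 1 ≤ M → IsUnitCost P M (c * M) := by
  have : ∀ R : FregeRule, ∃ c, R.Sound → ∀ (M : ℕ) (σ : ℕ → BoolFormula), (∀ i, (σ i).size ≤ M) →
      FregeEntails P {A | A ∈ R.premises.map (·.subst σ)} (R.conclusion.subst σ) (c * M) := by
    intro R
    by_cases hR : R.Sound
    · obtain ⟨c, hc⟩ := hR.exists_entails hP
      exact ⟨c, fun _ => hc⟩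
    · exact ⟨0, fun h => (hR h).elim⟩
  choose c hc using this
  obtain ⟨b, hb⟩ := (FregeRule.finite_setOf_small.image c).bddAbove
  exact ⟨b, fun M hM => ⟨hM, fun R h1 h2 σ hσ => (hc R h2 M σ hσ).mono_right
    (Nat.mul_le_mul_right M (hb ⟨R, h1, rfl⟩))⟩⟩

theorem IsUnitCost.infer {P : Set FregeRule} {M U : ℕ} (hU : IsUnitCost P M U)
    {Γ : Set BoolFormula} (Hs : List (BoolFormula × ℕ)) (A : BoolFormula) (L : List BoolFormula)
    (hR : FregeRule.Small ⟨Hs.map Prod.fst, A⟩) (hR' : FregeRule.Sound ⟨Hs.map Prod.fst, A⟩)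
    (hL : ∀ B ∈ L, B.size ≤ M)
    (h : ∀ H ∈ Hs, FregeEntails P Γ (H.1.subst fun i => L.getD i (.const false)) H.2) :
    FregeEntails P Γ (A.subst fun i => L.getD i (.const false)) ((Hs.map Prod.snd).sum + U) := by
  obtain ⟨hM, hU⟩ := hU
  -- Indices beyond `L` receive a constant of size 1, which `1 ≤ M` permits.
  have hσ : ∀ i, (L.getD i (.const false)).size ≤ M := by
    intro i
    by_cases hi : i < L.length
    · simpa [hi] using hL _ (List.getElem_mem hi)
    · simpa [List.getD, List.getElem?_eq_none (Nat.le_of_not_lt hi), BoolFormula.size] using hM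
  have := FregeEntails.cut_list (Γ := Γ)
    (Hs.map fun H => (H.1.subst fun i => L.getD i (.const false), H.2)) (List.forall_mem_map.2 h)
    (B := A.subst fun i => L.getD i (.const false)) (m := U) <| (hU _ hR hR' _ hσ).mono
      (by simp) le_rfl
  simpa [Function.comp_def] using this

/-! ### Leaves, right residuals and expansion coefficients -/

namespace NCFormula

variable {K : Type}

/-- The leaves of a formula that are labelled with a variable. -/
def Pos : NCFormula K → Type
  | var _ => Unit
  | const _ => Empty
  | add F G => Pos F ⊕ Pos G
  | mul F G => Pos F ⊕ Pos G

/-- The index of the variable at a leaf. -/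
def label : (F : NCFormula K) → F.Pos → ℕ
  | var i, _ => i
  | add F G, p => Sum.elim (label F) (label G) p
  | mul F G, p => Sum.elim (label F) (label G) p

/-- A numbering of the leaves from left to right. -/
def posIndex : (F : NCFormula K) → F.Pos → ℕ
  | var _, _ => 0
  | add F G, p => Sum.elim (posIndex F) (fun q => F.size + posIndex G q) p
  | mul F G, p => Sum.elim (posIndex F) (fun q => F.size + posIndex G q) p

theorem posIndex_lt : ∀ (F : NCFormula K) (p : F.Pos), F.posIndex p < F.size
  | var _, _ => Nat.one_pos
  | add F G, .inl p => by
    have := posIndex_lt F p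
    simp only [posIndex, Sum.elim_inl, size]
    omega
  | add F G, .inr p => by
    have := posIndex_lt G p
    simp only [posIndex, Sum.elim_inr, size]
    omega
  | mul F G, .inl p => by
    have := posIndex_lt F p
    simp only [posIndex, Sum.elim_inl, size]
    omega
  | mul F G, .inr p => by
    have := posIndex_lt G p
    simp only [posIndex, Sum.elim_inr, size]
    omega

theorem sumElim_posIndex_injective {F G : NCFormula K} (hF : F.posIndex.Injective)
    (hG : G.posIndex.Injective) :
    (Sum.elim F.posIndex fun q => F.size + G.posIndex q).Injective :=
  hF.sumElim (fun _ _ h => hG (Nat.add_left_cancel h)) fun p q => by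
    have := posIndex_lt F p
    omega

theorem posIndex_injective : ∀ F : NCFormula K, F.posIndex.Injective
  | var _ => fun _ _ _ => rfl
  | const _ => fun p => p.elim
  | add F G => sumElim_posIndex_injective F.posIndex_injective G.posIndex_injective
  | mul F G => sumElim_posIndex_injective F.posIndex_injective G.posIndex_injective

/-- The set of indices of variables of a formula. -/
def vars : NCFormula K → Finset ℕ
  | var i => {i}
  | const _ => ∅
  | add F G => vars F ∪ vars G
  | mul F G => vars F ∪ vars G

theorem card_vars_le (F : NCFormula K) : F.vars.card ≤ F.size := by
  induction F with
  | var i => simp [vars, size]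
  | const c => simp [vars]
  | add F G hF hG =>
    have := Finset.card_union_le F.vars G.vars
    simp only [vars, size]
    omega
  | mul F G hF hG =>
    have := Finset.card_union_le F.vars G.vars
    simp only [vars, size]
    omega

theorem label_mem_vars : ∀ (F : NCFormula K) (p : F.Pos), F.label p ∈ F.vars
  | var _, _ => by simp [vars, label]
  | add F G, .inl p => Finset.mem_union_left _ (label_mem_vars F p)
  | add F G, .inr p => Finset.mem_union_right _ (label_mem_vars G p)
  | mul F G, .inl p => Finset.mem_union_left _ (label_mem_vars F p)
  | mul F G, .inr p => Finset.mem_union_right _ (label_mem_vars G p)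

variable [Field K]

/-- The constant coefficient of the polynomial computed by a formula. -/
def constCoeff : NCFormula K → K
  | var _ => 0
  | const c => c
  | add F G => constCoeff F + constCoeff G
  | mul F G => constCoeff F * constCoeff G

/-- Every leaf `l` of `F` that carries a variable `xᵢ` has a right residual: the product of the
right factors met on the way up from `l` whenever `l` lies in the left factor. The formula
`residual g F u` computes the sum over all such leaves of `u l` times `g i` times the right residual
of `l`. -/
def residual (g : ℕ → NCFormula K) : (F : NCFormula K) → (F.Pos → K) → NCFormula K
  | var i, u => mul (const (u ())) (g i)
  | const _, _ => const 0
  | add F G, u => add (residual g F (u ∘ Sum.inl)) (residual g G (u ∘ Sum.inr))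
  | mul F G, u => add (mul (residual g F (u ∘ Sum.inl)) G) (residual g G (u ∘ Sum.inr))

/-- A linear combination of right residuals. -/
abbrev residualSum : (F : NCFormula K) → (F.Pos → K) → NCFormula K :=
  residual fun _ => const 1

/-- A linear combination of right residuals, each multiplied on the left by the variable of its
leaf. -/
abbrev varResidualSum : (F : NCFormula K) → (F.Pos → K) → NCFormula K :=
  residual var

/-- The coefficients in the expansion `F = c + ∑ₗ firstWeight F l * xₗ * Rₗ`. -/
def firstWeight : (F : NCFormula K) → F.Pos → K
  | var _ => fun _ => 1
  | const _ => fun _ => 0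
  | add F G => Sum.elim (firstWeight F) (firstWeight G)
  | mul F G => Sum.elim (firstWeight F) (constCoeff F • firstWeight G)

/-- The coefficients in the expansion `∑ₗ u l * Rₗ = c + ∑ₗ nextWeight F u l * xₗ * Rₗ`. -/
def nextWeight : (F : NCFormula K) → (F.Pos → K) → F.Pos → K
  | var _, _ => 0
  | const _, _ => 0
  | add F G, u => Sum.elim (nextWeight F (u ∘ Sum.inl)) (nextWeight G (u ∘ Sum.inr))
  | mul F G, u => Sum.elim (nextWeight F (u ∘ Sum.inl))
      (constCoeff (residualSum F (u ∘ Sum.inl)) • firstWeight G + nextWeight G (u ∘ Sum.inr))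

/-- The restriction of a weight to the leaves with label in `S`. -/
def restrict (F : NCFormula K) (S : Finset ℕ) (u : F.Pos → K) : F.Pos → K :=
  fun p => if F.label p ∈ S then u p else 0

theorem restrict_add (F : NCFormula K) (S : Finset ℕ) (u v : F.Pos → K) :
    F.restrict S (u + v) = F.restrict S u + F.restrict S v := by
  ext p
  by_cases h : F.label p ∈ S <;> simp [restrict, h]

theorem restrict_smul (F : NCFormula K) (S : Finset ℕ) (c : K) (u : F.Pos → K) :
    F.restrict S (c • u) = c • F.restrict S u := by
  ext p
  by_cases h : F.label p ∈ S <;> simp [restrict, h]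

theorem poly_residual_add (g : ℕ → NCFormula K) (F : NCFormula K) (u v : F.Pos → K) :
    (residual g F (u + v)).poly = (residual g F u).poly + (residual g F v).poly := by
  induction F with
  | var i =>
    change algebraMap K _ (u () + v ()) * (g i).poly =
      algebraMap K _ (u ()) * (g i).poly + algebraMap K _ (v ()) * (g i).poly
    rw [map_add, add_mul]
  | const c => simp [residual, poly]
  | add F G hF hG =>
    change (residual g F (u ∘ Sum.inl + v ∘ Sum.inl)).poly +
        (residual g G (u ∘ Sum.inr + v ∘ Sum.inr)).poly = _ + _ + (_ + _)
    rw [hF, hG, add_add_add_comm]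
  | mul F G hF hG =>
    change (residual g F (u ∘ Sum.inl + v ∘ Sum.inl)).poly * G.poly +
        (residual g G (u ∘ Sum.inr + v ∘ Sum.inr)).poly = _ * _ + _ + (_ * _ + _)
    rw [hF, hG, add_mul, add_add_add_comm]

theorem poly_residual_smul (g : ℕ → NCFormula K) (F : NCFormula K) (c : K) (u : F.Pos → K) :
    (residual g F (c • u)).poly = algebraMap K _ c * (residual g F u).poly := by
  induction F with
  | var i =>
    change algebraMap K _ (c * u ()) * (g i).poly =
      algebraMap K _ c * (algebraMap K _ (u ()) * (g i).poly)
    rw [map_mul, mul_assoc]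
  | const c => simp [residual, poly]
  | add F G hF hG =>
    change (residual g F (c • (u ∘ Sum.inl))).poly + (residual g G (c • (u ∘ Sum.inr))).poly =
      _ * (_ + _)
    rw [hF, hG, mul_add]
  | mul F G hF hG =>
    change (residual g F (c • (u ∘ Sum.inl))).poly * G.poly +
      (residual g G (c • (u ∘ Sum.inr))).poly = _ * (_ * _ + _)
    rw [hF, hG, mul_add, mul_assoc]

/-! ### Left quotients by a variable -/

/-- The algebra homomorphism that sends `f` to the upper triangular matrix whose diagonal consists
of the constant coefficient of `f` and of `f`, and whose corner is the sum of all `w` such that the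
monomial `xⱼ w` occurs in `f`. -/
noncomputable def derivHom (K : Type) [Field K] (j : ℕ) :
    FreeAlgebra K ℕ →ₐ[K] Matrix (Fin 2) (Fin 2) (FreeAlgebra K ℕ) :=
  FreeAlgebra.lift K fun i => !![0, if i = j then 1 else 0; 0, FreeAlgebra.ι K i]

theorem derivHom_algebraMap (j : ℕ) (c : K) :
    derivHom K j (algebraMap K _ c) = !![algebraMap K _ c, 0; 0, algebraMap K _ c] := by
  rw [AlgHom.commutes, Matrix.algebraMap_eq_diagonal]
  ext a b
  fin_cases a <;> fin_cases b <;> simp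

/-- Multiplying the triangular matrices gives the rule ∂(fg) = ∂f · g + f(0) · ∂g for the corner.
This is the recursion that defines `firstWeight`. -/
theorem derivHom_poly (j : ℕ) (F : NCFormula K) :
    derivHom K j F.poly = !![algebraMap K _ F.constCoeff,
      (residualSum F (F.restrict {j} F.firstWeight)).poly; 0, F.poly] := by
  induction F with
  | var i =>
    simp only [poly, derivHom, FreeAlgebra.lift_ι_apply, constCoeff, residual, restrict, label,
      firstWeight, map_zero, map_one, mul_one, Finset.mem_singleton, residualSum]
    split_ifs <;> simp
  | const c => rw [poly, derivHom_algebraMap, residualSum, residual, poly, map_zero, constCoeff]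
  | add F G hF hG =>
    rw [poly, map_add, hF, hG, constCoeff, map_add]
    ext a b
    fin_cases a <;> fin_cases b <;> first | rfl | simp
  | mul F G hF hG =>
    rw [poly, map_mul, hF, hG, constCoeff, map_mul, Matrix.mul_fin_two]
    have h : residualSum (mul F G) ((mul F G).restrict {j} (mul F G).firstWeight) =
        add (mul (residualSum F (F.restrict {j} F.firstWeight)) G)
          (residualSum G (F.constCoeff • G.restrict {j} G.firstWeight)) := by
      rw [← restrict_smul]
      rfl
    rw [h, poly, poly, residualSum, poly_residual_smul,
      add_comm (_ * G.poly)]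
    simp

/-- At a product the left residual sum is multiplied by `G`, so its constant coefficient meets ∂G.
This accounts for the additional `firstWeight G` term in `nextWeight`. -/
theorem derivHom_poly_residualSum (j : ℕ) (F : NCFormula K) (u : F.Pos → K) :
    derivHom K j (residualSum F u).poly 0 1 =
      (residualSum F (F.restrict {j} (F.nextWeight u))).poly := by
  induction F with
  | var i =>
    have : restrict (var i) {j} ((var i).nextWeight u) = fun _ => (0 : K) := by
      ext p
      simp [restrict, nextWeight]
    rw [this]
    simp only [residual, poly, map_mul, derivHom_algebraMap]
    simp
  | const c =>
    rw [residualSum, residual, poly, map_zero, map_zero]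
    rfl
  | add F G hF hG =>
    have h1 := hF (u ∘ Sum.inl)
    have h2 := hG (u ∘ Sum.inr)
    rw [residualSum, residual, poly, map_add, Matrix.add_apply, h1, h2]
    rfl
  | mul F G hF hG =>
    have h1 := hF (u ∘ Sum.inl)
    have h2 := hG (u ∘ Sum.inr)
    have h : residualSum (mul F G) ((mul F G).restrict {j} ((mul F G).nextWeight u)) =
        add (mul (residualSum F (F.restrict {j} (F.nextWeight (u ∘ Sum.inl)))) G)
          (residualSum G ((residualSum F (u ∘ Sum.inl)).constCoeff •
            G.restrict {j} G.firstWeight + G.restrict {j} (G.nextWeight (u ∘ Sum.inr)))) := by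
      rw [← restrict_smul, ← restrict_add]
      rfl
    have h3 : derivHom K j (residualSum F (u ∘ Sum.inl)).poly 0 0 =
        algebraMap K _ (residualSum F (u ∘ Sum.inl)).constCoeff := by
      rw [derivHom_poly]
      rfl
    rw [h, poly, poly, residualSum, poly_residual_add, poly_residual_smul, residual, poly, map_add,
      Matrix.add_apply, h2, poly, map_mul, Matrix.mul_apply, Fin.sum_univ_two, h1, h3,
      derivHom_poly j G]
    simp only [Matrix.of_apply, Matrix.cons_val', Matrix.cons_val_zero, Matrix.cons_val_one,
      Matrix.cons_val_fin_one]
    abel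

theorem constCoeff_eq_zero {F : NCFormula K} (h : F.poly = 0) : F.constCoeff = 0 := by
  have h1 := congrFun (congrFun (derivHom_poly 0 F) 0) 0
  rw [h, map_zero] at h1
  exact (FreeAlgebra.algebraMap_eq_zero_iff _).1 h1.symm

theorem poly_residualSum_firstWeight {F : NCFormula K} (h : F.poly = 0) (j : ℕ) :
    (residualSum F (F.restrict {j} F.firstWeight)).poly = 0 := by
  have h1 := congrFun (congrFun (derivHom_poly j F) 0) 1
  rw [h, map_zero] at h1
  exact h1.symm

theorem poly_residualSum_nextWeight {F : NCFormula K} {u : F.Pos → K}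
    (h : (residualSum F u).poly = 0) (j : ℕ) :
    (residualSum F (F.restrict {j} (F.nextWeight u))).poly = 0 := by
  rw [← derivHom_poly_residualSum, h, map_zero, Matrix.zero_apply]

/-! ### Triangularity and an echelon sequence of relations -/

/-- The weight vanishes on the leaves with number less than `k`. -/
def VanishesBelow (F : NCFormula K) (k : ℕ) (u : F.Pos → K) : Prop :=
  ∀ p, F.posIndex p < k → u p = 0

theorem VanishesBelow.restrict {F : NCFormula K} {k : ℕ} {u : F.Pos → K}
    (h : F.VanishesBelow k u) (S : Finset ℕ) : F.VanishesBelow k (F.restrict S u) := by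
  intro p hp
  simp [NCFormula.restrict, h p hp]

theorem constCoeff_residualSum_zero (F : NCFormula K) : (residualSum F 0).constCoeff = 0 := by
  induction F with
  | var i => exact zero_mul _
  | const c => rfl
  | add F G hF hG =>
    change (residualSum F 0).constCoeff + (residualSum G 0).constCoeff = 0
    rw [hF, hG, add_zero]
  | mul F G hF hG =>
    change (residualSum F 0).constCoeff * _ + (residualSum G 0).constCoeff = 0
    rw [hF, hG, add_zero, zero_mul]

/-- Expansion moves weight strictly to the right: the new term at a product passes weight from
leaves of the left factor to leaves of the right factor, and a single leaf passes on nothing. -/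
theorem VanishesBelow.nextWeight {F : NCFormula K} {k : ℕ} {u : F.Pos → K}
    (h : F.VanishesBelow k u) : F.VanishesBelow (k + 1) (F.nextWeight u) := by
  induction F generalizing k with
  | var i => exact fun p _ => rfl
  | const c => exact fun p _ => rfl
  | add F G hF hG =>
    have h1 : F.VanishesBelow k (u ∘ Sum.inl) := fun p hp => h (.inl p) hp
    have h2 : G.VanishesBelow (k - F.size) (u ∘ Sum.inr) := fun p hp =>
      h (.inr p) (by simp only [posIndex, Sum.elim_inr]; omega)
    rintro (p | p) hp
    · exact hF h1 p hp
    · simp only [posIndex, Sum.elim_inr] at hp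
      exact hG h2 p (by omega)
  | mul F G hF hG =>
    have h1 : F.VanishesBelow k (u ∘ Sum.inl) := fun p hp => h (.inl p) hp
    have h2 : G.VanishesBelow (k - F.size) (u ∘ Sum.inr) := fun p hp =>
      h (.inr p) (by simp only [posIndex, Sum.elim_inr]; omega)
    rintro (p | p) hp
    · exact hF h1 p hp
    · simp only [posIndex, Sum.elim_inr] at hp
      -- The bound `hp` on a leaf of `G` forces `F.size ≤ k`, so `u` vanishes on the whole left
      -- factor and passes nothing to `G`.
      have h3 : u ∘ Sum.inl = 0 := by
        ext q
        have := F.posIndex_lt q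
        exact h1 q (by omega)
      simp only [NCFormula.nextWeight, Sum.elim_inr, h3, constCoeff_residualSum_zero, zero_smul,
        zero_add]
      exact hG h2 p (by omega)

theorem VanishesBelow.eq_zero {F : NCFormula K} {u : F.Pos → K} (h : F.VanishesBelow F.size u) :
    u = 0 :=
  funext fun p => h p (F.posIndex_lt p)

/-- The weights with `∑ₗ u l * Rₗ = 0` have an echelon spanning sequence. -/
theorem exists_echelon (F : NCFormula (ZMod 2)) :
    ∃ w : ℕ → F.Pos → ZMod 2,
      (∀ k, (residualSum F (w k)).poly = 0 ∧ F.VanishesBelow k (w k)) ∧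
      ∀ k u, (residualSum F u).poly = 0 → F.VanishesBelow k u →
        F.VanishesBelow (k + 1) u ∨ F.VanishesBelow (k + 1) (u + w k) := by
  suffices ∀ k, ∃ w : F.Pos → ZMod 2,
      ((residualSum F w).poly = 0 ∧ F.VanishesBelow k w) ∧
      ∀ u, (residualSum F u).poly = 0 → F.VanishesBelow k u →
        F.VanishesBelow (k + 1) u ∨ F.VanishesBelow (k + 1) (u + w) by
    choose w h1 h2 using this
    exact ⟨w, h1, h2⟩
  intro k
  -- Either some relation vanishing below `k` has a pivot at leaf `k`, and adding it clears that
  -- entry over GF(2), or every such relation already vanishes there and 0 serves.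
  by_cases h : ∃ w, ((residualSum F w).poly = 0 ∧ F.VanishesBelow k w) ∧
      ∃ p, F.posIndex p = k ∧ w p ≠ 0
  · obtain ⟨w, hw, p, hp, hwp⟩ := h
    refine ⟨w, hw, fun u _ hu' => ?_⟩
    have key : ∀ v, F.VanishesBelow k v → v p = 0 → F.VanishesBelow (k + 1) v := by
      intro v hv hvp q hq
      rcases Nat.lt_succ_iff_lt_or_eq.1 hq with hq | hq
      · exact hv q hq
      · rwa [F.posIndex_injective (hq.trans hp.symm)]
    by_cases hup : u p = 0
    · exact .inl (key u hu' hup)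
    · refine .inr (key _ (fun q hq => ?_) ?_)
      · simp [hu' q hq, hw.2 q hq]
      · rw [Pi.add_apply]
        generalize u p = x at *
        generalize w p = y at *
        revert x y
        decide
  · push Not at h
    refine ⟨0, ⟨?_, fun _ _ => rfl⟩, fun u hu hu' => .inl fun q hq => ?_⟩
    · simpa using poly_residual_add (fun _ => const 1) F (0 : F.Pos → ZMod 2) 0
    · rcases Nat.lt_succ_iff_lt_or_eq.1 hq with hq | hq
      · exact hu' q hq
      · exact h u ⟨hu, hu'⟩ q hq

end NCFormula

/-! ### Small sound rules for the inductions along a formula -/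

namespace BoolFormula

/-- The constant formula of an element of GF(2). -/
def bit (c : ZMod 2) : BoolFormula :=
  const (decide (c = 1))

theorem eval_bit_add (v : ℕ → Bool) (x y : ZMod 2) :
    (bit (x + y)).eval v = ((bit x).eval v ^^ (bit y).eval v) := by
  revert x y
  simp only [bit, eval]
  decide

theorem eval_bit_mul (v : ℕ → Bool) (x y : ZMod 2) :
    (bit (x * y)).eval v = ((bit x).eval v && (bit y).eval v) := by
  revert x y
  simp only [bit, eval]
  decide

theorem eval_bit_zero (v : ℕ → Bool) : (bit 0).eval v = false := rfl

theorem eval_bit_one (v : ℕ → Bool) : (bit 1).eval v = true := rfl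

end BoolFormula

namespace IsUnitCost

open BoolFormula

attribute [local simp] size VarsBelow iff BoolFormula.xor bit

set_option linter.unusedSimpArgs false

variable {P : Set FregeRule} {M U : ℕ} {Γ : Set BoolFormula} {n₁ n₂ n₃ n₄ n₅ : ℕ}

theorem add_leaf (hU : IsUnitCost P M U) {A : BoolFormula} (x y : ZMod 2)
    (hL : ∀ C ∈ [A], C.size ≤ M) :
    FregeEntails P Γ (iff (and (bit (x + y)) A) (xor (and (bit x) A) (and (bit y) A))) (U) :=
  (hU.infer []
    (iff (and (bit (x + y)) (var 0)) (xor (and (bit x) (var 0)) (and (bit y) (var 0)))) _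
    (by simp [FregeRule.Small])
    (by
      intro v _
      simp only [List.map, List.forall_mem_cons, eval, eval_iff, eval_xor, beq_iff_eq, eval_bit_add,
        eval_bit_mul, eval_bit_zero, eval_bit_one]
      cases v 0 <;> cases (bit x).eval v <;> cases (bit y).eval v <;> rfl)
    hL
    (List.forall_mem_nil _)).mono_right
    (by simp only [List.map, List.sum_cons, List.sum_nil]; omega)

theorem bit_xor_zero (hU : IsUnitCost P M U) (x : ZMod 2) :
    FregeEntails P Γ (iff (bit x) (xor (bit x) (bit 0))) (U) :=
  (hU.infer []
    (iff (bit x) (xor (bit x) (bit 0))) []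
    (by simp [FregeRule.Small])
    (by
      intro v _
      simp only [List.map, List.forall_mem_cons, eval, eval_iff, eval_xor, beq_iff_eq, eval_bit_add,
        eval_bit_mul, eval_bit_zero, eval_bit_one]
      cases (bit x).eval v <;> rfl)
    (List.forall_mem_nil _)
    (List.forall_mem_nil _)).mono_right
    (by simp only [List.map, List.sum_cons, List.sum_nil]; omega)

theorem xor_xor_xor (hU : IsUnitCost P M U) {X X₁ X₂ Y Y₁ Y₂ : BoolFormula}
    (hL : ∀ C ∈ [X, X₁, X₂, Y, Y₁, Y₂], C.size ≤ M)
    (h₁ : FregeEntails P Γ (iff X (xor X₁ X₂)) n₁)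
    (h₂ : FregeEntails P Γ (iff Y (xor Y₁ Y₂)) n₂) :
    FregeEntails P Γ (iff (xor X Y) (xor (xor X₁ Y₁) (xor X₂ Y₂))) (n₁ + n₂ + U) :=
  (hU.infer [(iff (var 0) (xor (var 1) (var 2)), n₁),
      (iff (var 3) (xor (var 4) (var 5)), n₂)]
    (iff (xor (var 0) (var 3)) (xor (xor (var 1) (var 4)) (xor (var 2) (var 5)))) _
    (by simp [FregeRule.Small])
    (by
      intro v h
      simp only [List.map, List.forall_mem_cons, eval, eval_iff, eval_xor, beq_iff_eq, eval_bit_add,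
        eval_bit_mul, eval_bit_zero, eval_bit_one] at h ⊢
      simp only [h]
      cases v 1 <;> cases v 2 <;> cases v 4 <;> cases v 5 <;> rfl)
    hL
    (List.forall_mem_cons.2 ⟨h₁, List.forall_mem_cons.2 ⟨h₂, List.forall_mem_nil _⟩⟩)).mono_right
    (by simp only [List.map, List.sum_cons, List.sum_nil]; omega)

theorem and_xor_xor_xor (hU : IsUnitCost P M U) {X X₁ X₂ Y Y₁ Y₂ G : BoolFormula}
    (hL : ∀ C ∈ [X, X₁, X₂, Y, Y₁, Y₂, G], C.size ≤ M)
    (h₁ : FregeEntails P Γ (iff X (xor X₁ X₂)) n₁)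
    (h₂ : FregeEntails P Γ (iff Y (xor Y₁ Y₂)) n₂) :
    FregeEntails P Γ (iff (xor (and X G) Y) (xor (xor (and X₁ G) Y₁) (xor (and X₂ G) Y₂))) (n₁ + n₂ + U) :=
  (hU.infer [(iff (var 0) (xor (var 1) (var 2)), n₁),
      (iff (var 3) (xor (var 4) (var 5)), n₂)]
    (iff (xor (and (var 0) (var 6)) (var 3)) (xor (xor (and (var 1) (var 6)) (var 4)) (xor (and (var 2) (var 6)) (var 5)))) _
    (by simp [FregeRule.Small])
    (by
      intro v h
      simp only [List.map, List.forall_mem_cons, eval, eval_iff, eval_xor, beq_iff_eq, eval_bit_add,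
        eval_bit_mul, eval_bit_zero, eval_bit_one] at h ⊢
      simp only [h]
      cases v 1 <;> cases v 2 <;> cases v 4 <;> cases v 5 <;> cases v 6 <;> rfl)
    hL
    (List.forall_mem_cons.2 ⟨h₁, List.forall_mem_cons.2 ⟨h₂, List.forall_mem_nil _⟩⟩)).mono_right
    (by simp only [List.map, List.sum_cons, List.sum_nil]; omega)

theorem zero_and (hU : IsUnitCost P M U) {A B : BoolFormula}
    (hL : ∀ C ∈ [A, B], C.size ≤ M) :
    FregeEntails P Γ (iff (and (bit 0) A) (and B (and (bit 0) (bit 1)))) (U) :=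
  (hU.infer []
    (iff (and (bit 0) (var 0)) (and (var 1) (and (bit 0) (bit 1)))) _
    (by simp [FregeRule.Small])
    (by
      intro v _
      simp only [List.map, List.forall_mem_cons, eval, eval_iff, eval_xor, beq_iff_eq, eval_bit_add,
        eval_bit_mul, eval_bit_zero, eval_bit_one]
      cases v 0 <;> cases v 1 <;> rfl)
    hL
    (List.forall_mem_nil _)).mono_right
    (by simp only [List.map, List.sum_cons, List.sum_nil]; omega)

theorem and_comm_leaf (hU : IsUnitCost P M U) {A : BoolFormula} (x : ZMod 2)
    (hL : ∀ C ∈ [A], C.size ≤ M) :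
    FregeEntails P Γ (iff (and (bit x) A) (and A (and (bit x) (bit 1)))) (U) :=
  (hU.infer []
    (iff (and (bit x) (var 0)) (and (var 0) (and (bit x) (bit 1)))) _
    (by simp [FregeRule.Small])
    (by
      intro v _
      simp only [List.map, List.forall_mem_cons, eval, eval_iff, eval_xor, beq_iff_eq, eval_bit_add,
        eval_bit_mul, eval_bit_zero, eval_bit_one]
      cases v 0 <;> cases (bit x).eval v <;> rfl)
    hL
    (List.forall_mem_nil _)).mono_right
    (by simp only [List.map, List.sum_cons, List.sum_nil]; omega)

theorem and_zero (hU : IsUnitCost P M U) {A : BoolFormula}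
    (hL : ∀ C ∈ [A], C.size ≤ M) :
    FregeEntails P Γ (iff (bit 0) (and A (bit 0))) (U) :=
  (hU.infer []
    (iff (bit 0) (and (var 0) (bit 0))) _
    (by simp [FregeRule.Small])
    (by
      intro v _
      simp only [List.map, List.forall_mem_cons, eval, eval_iff, eval_xor, beq_iff_eq, eval_bit_add,
        eval_bit_mul, eval_bit_zero, eval_bit_one]
      cases v 0 <;> rfl)
    hL
    (List.forall_mem_nil _)).mono_right
    (by simp only [List.map, List.sum_cons, List.sum_nil]; omega)

theorem and_distrib_xor (hU : IsUnitCost P M U) {A X X₁ Y Y₁ : BoolFormula}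
    (hL : ∀ C ∈ [A, X, X₁, Y, Y₁], C.size ≤ M)
    (h₁ : FregeEntails P Γ (iff X (and A X₁)) n₁)
    (h₂ : FregeEntails P Γ (iff Y (and A Y₁)) n₂) :
    FregeEntails P Γ (iff (xor X Y) (and A (xor X₁ Y₁))) (n₁ + n₂ + U) :=
  (hU.infer [(iff (var 1) (and (var 0) (var 2)), n₁),
      (iff (var 3) (and (var 0) (var 4)), n₂)]
    (iff (xor (var 1) (var 3)) (and (var 0) (xor (var 2) (var 4)))) _
    (by simp [FregeRule.Small])
    (by
      intro v h
      simp only [List.map, List.forall_mem_cons, eval, eval_iff, eval_xor, beq_iff_eq, eval_bit_add,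
        eval_bit_mul, eval_bit_zero, eval_bit_one] at h ⊢
      simp only [h]
      cases v 0 <;> cases v 2 <;> cases v 4 <;> rfl)
    hL
    (List.forall_mem_cons.2 ⟨h₁, List.forall_mem_cons.2 ⟨h₂, List.forall_mem_nil _⟩⟩)).mono_right
    (by simp only [List.map, List.sum_cons, List.sum_nil]; omega)

theorem and_distrib_and_xor (hU : IsUnitCost P M U) {A X X₁ Y Y₁ G : BoolFormula}
    (hL : ∀ C ∈ [A, X, X₁, Y, Y₁, G], C.size ≤ M)
    (h₁ : FregeEntails P Γ (iff X (and A X₁)) n₁)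
    (h₂ : FregeEntails P Γ (iff Y (and A Y₁)) n₂) :
    FregeEntails P Γ (iff (xor (and X G) Y) (and A (xor (and X₁ G) Y₁))) (n₁ + n₂ + U) :=
  (hU.infer [(iff (var 1) (and (var 0) (var 2)), n₁),
      (iff (var 3) (and (var 0) (var 4)), n₂)]
    (iff (xor (and (var 1) (var 5)) (var 3)) (and (var 0) (xor (and (var 2) (var 5)) (var 4)))) _
    (by simp [FregeRule.Small])
    (by
      intro v h
      simp only [List.map, List.forall_mem_cons, eval, eval_iff, eval_xor, beq_iff_eq, eval_bit_add,
        eval_bit_mul, eval_bit_zero, eval_bit_one] at h ⊢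
      simp only [h]
      cases v 0 <;> cases v 2 <;> cases v 4 <;> cases v 5 <;> rfl)
    hL
    (List.forall_mem_cons.2 ⟨h₁, List.forall_mem_cons.2 ⟨h₂, List.forall_mem_nil _⟩⟩)).mono_right
    (by simp only [List.map, List.sum_cons, List.sum_nil]; omega)

/-- The premise forces `X` to be false. It arises from additivity applied to 0 + 0 = 0. -/
theorem zero_smul (hU : IsUnitCost P M U) {X Y : BoolFormula}
    (hL : ∀ C ∈ [X, Y], C.size ≤ M)
    (h₁ : FregeEntails P Γ (iff X (xor X X)) n₁) :
    FregeEntails P Γ (iff X (and (bit 0) Y)) (n₁ + U) :=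
  (hU.infer [(iff (var 0) (xor (var 0) (var 0)), n₁)]
    (iff (var 0) (and (bit 0) (var 1))) _
    (by simp [FregeRule.Small])
    (by
      intro v h
      simp only [List.map, List.forall_mem_cons, eval, eval_iff, eval_xor, beq_iff_eq, eval_bit_add,
        eval_bit_mul, eval_bit_zero, eval_bit_one] at h ⊢
      revert h
      cases v 0 <;> cases v 1 <;> simp)
    hL
    (List.forall_mem_cons.2 ⟨h₁, List.forall_mem_nil _⟩)).mono_right
    (by simp only [List.map, List.sum_cons, List.sum_nil]; omega)

theorem one_smul (hU : IsUnitCost P M U) {X : BoolFormula}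
    (hL : ∀ C ∈ [X], C.size ≤ M) :
    FregeEntails P Γ (iff X (and (bit 1) X)) (U) :=
  (hU.infer []
    (iff (var 0) (and (bit 1) (var 0))) _
    (by simp [FregeRule.Small])
    (by
      intro v _
      simp only [List.map, List.forall_mem_cons, eval, eval_iff, eval_xor, beq_iff_eq, eval_bit_add,
        eval_bit_mul, eval_bit_zero, eval_bit_one]
      cases v 0 <;> rfl)
    hL
    (List.forall_mem_nil _)).mono_right
    (by simp only [List.map, List.sum_cons, List.sum_nil]; omega)

theorem expand_var (hU : IsUnitCost P M U) {A : BoolFormula}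
    (hL : ∀ C ∈ [A], C.size ≤ M) :
    FregeEntails P Γ (iff A (xor (bit 0) (and (bit 1) A))) (U) :=
  (hU.infer []
    (iff (var 0) (xor (bit 0) (and (bit 1) (var 0)))) _
    (by simp [FregeRule.Small])
    (by
      intro v _
      simp only [List.map, List.forall_mem_cons, eval, eval_iff, eval_xor, beq_iff_eq, eval_bit_add,
        eval_bit_mul, eval_bit_zero, eval_bit_one]
      cases v 0 <;> rfl)
    hL
    (List.forall_mem_nil _)).mono_right
    (by simp only [List.map, List.sum_cons, List.sum_nil]; omega)

theorem expand_leaf (hU : IsUnitCost P M U) {A : BoolFormula} (x : ZMod 2)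
    (hL : ∀ C ∈ [A], C.size ≤ M) :
    FregeEntails P Γ (iff (and (bit x) (bit 1)) (xor (bit (x * 1)) (and (bit 0) A))) (U) :=
  (hU.infer []
    (iff (and (bit x) (bit 1)) (xor (bit (x * 1)) (and (bit 0) (var 0)))) _
    (by simp [FregeRule.Small])
    (by
      intro v _
      simp only [List.map, List.forall_mem_cons, eval, eval_iff, eval_xor, beq_iff_eq, eval_bit_add,
        eval_bit_mul, eval_bit_zero, eval_bit_one]
      cases v 0 <;> cases (bit x).eval v <;> rfl)
    hL
    (List.forall_mem_nil _)).mono_right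
    (by simp only [List.map, List.sum_cons, List.sum_nil]; omega)

theorem expand_xor (hU : IsUnitCost P M U) {A X B Y : BoolFormula} (x y : ZMod 2)
    (hL : ∀ C ∈ [A, X, B, Y], C.size ≤ M)
    (h₁ : FregeEntails P Γ (iff A (xor (bit x) X)) n₁)
    (h₂ : FregeEntails P Γ (iff B (xor (bit y) Y)) n₂) :
    FregeEntails P Γ (iff (xor A B) (xor (bit (x + y)) (xor X Y))) (n₁ + n₂ + U) :=
  (hU.infer [(iff (var 0) (xor (bit x) (var 1)), n₁),
      (iff (var 2) (xor (bit y) (var 3)), n₂)]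
    (iff (xor (var 0) (var 2)) (xor (bit (x + y)) (xor (var 1) (var 3)))) _
    (by simp [FregeRule.Small])
    (by
      intro v h
      simp only [List.map, List.forall_mem_cons, eval, eval_iff, eval_xor, beq_iff_eq, eval_bit_add,
        eval_bit_mul, eval_bit_zero, eval_bit_one] at h ⊢
      simp only [h]
      cases v 1 <;> cases v 3 <;> cases (bit x).eval v <;> cases (bit y).eval v <;> rfl)
    hL
    (List.forall_mem_cons.2 ⟨h₁, List.forall_mem_cons.2 ⟨h₂, List.forall_mem_nil _⟩⟩)).mono_right
    (by simp only [List.map, List.sum_cons, List.sum_nil]; omega)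

theorem expand_and (hU : IsUnitCost P M U) {A X G Y Z : BoolFormula} (x y : ZMod 2)
    (hL : ∀ C ∈ [A, X, G, Y, Z], C.size ≤ M)
    (h₁ : FregeEntails P Γ (iff A (xor (bit x) X)) n₁)
    (h₂ : FregeEntails P Γ (iff G (xor (bit y) Y)) n₂)
    (h₃ : FregeEntails P Γ (iff Z (and (bit x) Y)) n₃) :
    FregeEntails P Γ (iff (and A G) (xor (bit (x * y)) (xor (and X G) Z))) (n₁ + n₂ + n₃ + U) :=
  (hU.infer [(iff (var 0) (xor (bit x) (var 1)), n₁),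
      (iff (var 2) (xor (bit y) (var 3)), n₂),
      (iff (var 4) (and (bit x) (var 3)), n₃)]
    (iff (and (var 0) (var 2)) (xor (bit (x * y)) (xor (and (var 1) (var 2)) (var 4)))) _
    (by simp [FregeRule.Small])
    (by
      intro v h
      simp only [List.map, List.forall_mem_cons, eval, eval_iff, eval_xor, beq_iff_eq, eval_bit_add,
        eval_bit_mul, eval_bit_zero, eval_bit_one] at h ⊢
      simp only [h]
      cases v 1 <;> cases v 3 <;> cases (bit x).eval v <;> cases (bit y).eval v <;> rfl)
    hL
    (List.forall_mem_cons.2 ⟨h₁, List.forall_mem_cons.2 ⟨h₂, List.forall_mem_cons.2 ⟨h₃, List.forall_mem_nil _⟩⟩⟩)).mono_right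
    (by simp only [List.map, List.sum_cons, List.sum_nil]; omega)

/-- This is the product case for residual sums: `A` and `B` are the sums of the two factors, `G` is
the right factor, and `Q` collects the contribution `Z` passed on from `A` together with the
expansion `W` of `B`. -/
theorem expand_and_xor (hU : IsUnitCost P M U) {A X B W G Y Q Z : BoolFormula} (x y z : ZMod 2)
    (hL : ∀ C ∈ [A, X, B, W, G, Y, Q, Z], C.size ≤ M)
    (h₁ : FregeEntails P Γ (iff A (xor (bit x) X)) n₁)
    (h₂ : FregeEntails P Γ (iff B (xor (bit z) W)) n₂)
    (h₃ : FregeEntails P Γ (iff G (xor (bit y) Y)) n₃)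
    (h₄ : FregeEntails P Γ (iff Q (xor Z W)) n₄)
    (h₅ : FregeEntails P Γ (iff Z (and (bit x) Y)) n₅) :
    FregeEntails P Γ (iff (xor (and A G) B) (xor (bit (x * y + z)) (xor (and X G) Q))) (n₁ + n₂ + n₃ + n₄ + n₅ + U) :=
  (hU.infer [(iff (var 0) (xor (bit x) (var 1)), n₁),
      (iff (var 2) (xor (bit z) (var 3)), n₂),
      (iff (var 4) (xor (bit y) (var 5)), n₃),
      (iff (var 6) (xor (var 7) (var 3)), n₄),
      (iff (var 7) (and (bit x) (var 5)), n₅)]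
    (iff (xor (and (var 0) (var 4)) (var 2)) (xor (bit (x * y + z)) (xor (and (var 1) (var 4)) (var 6)))) _
    (by simp [FregeRule.Small])
    (by
      intro v h
      simp only [List.map, List.forall_mem_cons, eval, eval_iff, eval_xor, beq_iff_eq, eval_bit_add,
        eval_bit_mul, eval_bit_zero, eval_bit_one] at h ⊢
      simp only [h]
      cases v 1 <;> cases v 3 <;> cases v 5 <;> cases (bit x).eval v <;> cases (bit y).eval v <;>
        cases (bit z).eval v <;> rfl)
    hL
    (List.forall_mem_cons.2 ⟨h₁, List.forall_mem_cons.2 ⟨h₂, List.forall_mem_cons.2 ⟨h₃, List.forall_mem_cons.2 ⟨h₄, List.forall_mem_cons.2 ⟨h₅, List.forall_mem_nil _⟩⟩⟩⟩⟩)).mono_right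
    (by simp only [List.map, List.sum_cons, List.sum_nil]; omega)

theorem neg_of_xor (hU : IsUnitCost P M U) {X Y Z : BoolFormula}
    (hL : ∀ C ∈ [X, Y, Z], C.size ≤ M)
    (h₁ : FregeEntails P Γ (iff Z (xor X Y)) n₁)
    (h₂ : FregeEntails P Γ (neg X) n₂)
    (h₃ : FregeEntails P Γ (neg Y) n₃) :
    FregeEntails P Γ (neg Z) (n₁ + n₂ + n₃ + U) :=
  (hU.infer [(iff (var 2) (xor (var 0) (var 1)), n₁),
      (neg (var 0), n₂),
      (neg (var 1), n₃)]
    (neg (var 2)) _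
    (by simp [FregeRule.Small])
    (by
      intro v h
      simp only [List.map, List.forall_mem_cons, eval, eval_iff, eval_xor, beq_iff_eq, eval_bit_add,
        eval_bit_mul, eval_bit_zero, eval_bit_one] at h ⊢
      revert h
      cases v 0 <;> cases v 1 <;> cases v 2 <;> simp)
    hL
    (List.forall_mem_cons.2 ⟨h₁, List.forall_mem_cons.2 ⟨h₂, List.forall_mem_cons.2 ⟨h₃, List.forall_mem_nil _⟩⟩⟩)).mono_right
    (by simp only [List.map, List.sum_cons, List.sum_nil]; omega)

theorem neg_of_xor_self (hU : IsUnitCost P M U) {X : BoolFormula}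
    (hL : ∀ C ∈ [X], C.size ≤ M)
    (h₁ : FregeEntails P Γ (iff X (xor X X)) n₁) :
    FregeEntails P Γ (neg X) (n₁ + U) :=
  (hU.infer [(iff (var 0) (xor (var 0) (var 0)), n₁)]
    (neg (var 0)) _
    (by simp [FregeRule.Small])
    (by
      intro v h
      simp only [List.map, List.forall_mem_cons, eval, eval_iff, eval_xor, beq_iff_eq, eval_bit_add,
        eval_bit_mul, eval_bit_zero, eval_bit_one] at h ⊢
      revert h
      cases v 0 <;> simp)
    hL
    (List.forall_mem_cons.2 ⟨h₁, List.forall_mem_nil _⟩)).mono_right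
    (by simp only [List.map, List.sum_cons, List.sum_nil]; omega)

theorem neg_of_and (hU : IsUnitCost P M U) {A X Z : BoolFormula}
    (hL : ∀ C ∈ [A, X, Z], C.size ≤ M)
    (h₁ : FregeEntails P Γ (iff Z (and A X)) n₁)
    (h₂ : FregeEntails P Γ (neg X) n₂) :
    FregeEntails P Γ (neg Z) (n₁ + n₂ + U) :=
  (hU.infer [(iff (var 2) (and (var 0) (var 1)), n₁),
      (neg (var 1), n₂)]
    (neg (var 2)) _
    (by simp [FregeRule.Small])
    (by
      intro v h
      simp only [List.map, List.forall_mem_cons, eval, eval_iff, eval_xor, beq_iff_eq, eval_bit_add,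
        eval_bit_mul, eval_bit_zero, eval_bit_one] at h ⊢
      revert h
      cases v 0 <;> cases v 1 <;> cases v 2 <;> simp)
    hL
    (List.forall_mem_cons.2 ⟨h₁, List.forall_mem_cons.2 ⟨h₂, List.forall_mem_nil _⟩⟩)).mono_right
    (by simp only [List.map, List.sum_cons, List.sum_nil]; omega)

theorem neg_of_zero_xor (hU : IsUnitCost P M U) {X Z : BoolFormula}
    (hL : ∀ C ∈ [X, Z], C.size ≤ M)
    (h₁ : FregeEntails P Γ (iff Z (xor (bit 0) X)) n₁)
    (h₂ : FregeEntails P Γ (neg X) n₂) :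
    FregeEntails P Γ (neg Z) (n₁ + n₂ + U) :=
  (hU.infer [(iff (var 1) (xor (bit 0) (var 0)), n₁),
      (neg (var 0), n₂)]
    (neg (var 1)) _
    (by simp [FregeRule.Small])
    (by
      intro v h
      simp only [List.map, List.forall_mem_cons, eval, eval_iff, eval_xor, beq_iff_eq, eval_bit_add,
        eval_bit_mul, eval_bit_zero, eval_bit_one] at h ⊢
      revert h
      cases v 0 <;> cases v 1 <;> simp)
    hL
    (List.forall_mem_cons.2 ⟨h₁, List.forall_mem_cons.2 ⟨h₂, List.forall_mem_nil _⟩⟩)).mono_right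
    (by simp only [List.map, List.sum_cons, List.sum_nil]; omega)

end IsUnitCost

/-! ### Short proofs of the linear identities and expansions -/

namespace NCFormula

open BoolFormula (bit iff)

theorem size_toBool_le (F : NCFormula (ZMod 2)) : F.toBool.size ≤ 3 * 16 ^ F.depth := by
  induction F with
  | var i => simp [toBool, BoolFormula.size, depth]
  | const c => simp [toBool, BoolFormula.size, depth]
  | add F G hF hG =>
    have h1 := Nat.pow_le_pow_right (n := 16) (by norm_num) (le_max_left F.depth G.depth)
    have h2 := Nat.pow_le_pow_right (n := 16) (by norm_num) (le_max_right F.depth G.depth)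
    have h3 : 1 ≤ 16 ^ max F.depth G.depth := Nat.one_le_pow _ _ (by norm_num)
    simp only [toBool, BoolFormula.xor, BoolFormula.size, depth, pow_succ]
    omega
  | mul F G hF hG =>
    have h1 := Nat.pow_le_pow_right (n := 16) (by norm_num) (le_max_left F.depth G.depth)
    have h2 := Nat.pow_le_pow_right (n := 16) (by norm_num) (le_max_right F.depth G.depth)
    have h3 : 1 ≤ 16 ^ max F.depth G.depth := Nat.one_le_pow _ _ (by norm_num)
    simp only [toBool, BoolFormula.size, depth, pow_succ]
    omega

theorem size_toBool_residual_le {g : ℕ → NCFormula (ZMod 2)} (hg : ∀ i, (g i).toBool.size ≤ 1)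
    (F : NCFormula (ZMod 2)) (u : F.Pos → ZMod 2) :
    (residual g F u).toBool.size ≤ 3 * 16 ^ F.depth := by
  induction F with
  | var i =>
    have := hg i
    simp only [residual, toBool, BoolFormula.size, depth, pow_zero]
    omega
  | const c => simp [residual, toBool, BoolFormula.size, depth]
  | add F G hF hG =>
    have h1 := Nat.pow_le_pow_right (n := 16) (by norm_num) (le_max_left F.depth G.depth)
    have h2 := Nat.pow_le_pow_right (n := 16) (by norm_num) (le_max_right F.depth G.depth)
    have h3 : 1 ≤ 16 ^ max F.depth G.depth := Nat.one_le_pow _ _ (by norm_num)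
    have h4 := hF (u ∘ Sum.inl)
    have h5 := hG (u ∘ Sum.inr)
    simp only [residual, toBool, BoolFormula.xor, BoolFormula.size, depth, pow_succ] at *
    omega
  | mul F G hF hG =>
    have h1 := Nat.pow_le_pow_right (n := 16) (by norm_num) (le_max_left F.depth G.depth)
    have h2 := Nat.pow_le_pow_right (n := 16) (by norm_num) (le_max_right F.depth G.depth)
    have h3 : 1 ≤ 16 ^ max F.depth G.depth := Nat.one_le_pow _ _ (by norm_num)
    have h4 := hF (u ∘ Sum.inl)
    have h5 := hG (u ∘ Sum.inr)
    have h6 := size_toBool_le G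
    simp only [residual, toBool, BoolFormula.xor, BoolFormula.size, depth, pow_succ] at *
    omega

/-- A bound on the sizes of all Boolean formulas built from subformulas of `F`. -/
def Fits (F : NCFormula (ZMod 2)) (M : ℕ) : Prop :=
  3 * 16 ^ F.depth ≤ M

variable {P : Set FregeRule} {M U S : ℕ} {Γ : Set BoolFormula} {g : ℕ → NCFormula (ZMod 2)}

theorem Fits.of_le {F G : NCFormula (ZMod 2)} (h : G.Fits M) (hFG : F.depth ≤ G.depth) :
    F.Fits M :=
  (Nat.mul_le_mul_left 3 (Nat.pow_le_pow_right (by norm_num) hFG)).trans h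

theorem Fits.add_left {F G : NCFormula (ZMod 2)} (h : (add F G).Fits M) : F.Fits M :=
  h.of_le ((le_max_left _ _).trans (Nat.le_succ _))

theorem Fits.add_right {F G : NCFormula (ZMod 2)} (h : (add F G).Fits M) : G.Fits M :=
  h.of_le ((le_max_right _ _).trans (Nat.le_succ _))

theorem Fits.mul_left {F G : NCFormula (ZMod 2)} (h : (mul F G).Fits M) : F.Fits M :=
  h.of_le ((le_max_left _ _).trans (Nat.le_succ _))

theorem Fits.mul_right {F G : NCFormula (ZMod 2)} (h : (mul F G).Fits M) : G.Fits M :=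
  h.of_le ((le_max_right _ _).trans (Nat.le_succ _))

theorem Fits.one_le {F : NCFormula (ZMod 2)} (h : F.Fits M) : 1 ≤ M := by
  have h3 : 1 ≤ 16 ^ F.depth := Nat.one_le_pow _ _ (by norm_num)
  unfold Fits at h
  omega

theorem Fits.toBool {F : NCFormula (ZMod 2)} (h : F.Fits M) : F.toBool.size ≤ M :=
  (size_toBool_le F).trans h

theorem Fits.residual {F : NCFormula (ZMod 2)} (h : F.Fits M) (hg : ∀ i, (g i).toBool.size ≤ 1)
    (u : F.Pos → ZMod 2) : (residual g F u).toBool.size ≤ M :=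
  (size_toBool_residual_le hg F u).trans h

theorem Fits.residualSum {F : NCFormula (ZMod 2)} (h : F.Fits M) (u : F.Pos → ZMod 2) :
    (residualSum F u).toBool.size ≤ M :=
  h.residual (fun _ => le_rfl) u

theorem Fits.varResidualSum {F : NCFormula (ZMod 2)} (h : F.Fits M) (u : F.Pos → ZMod 2) :
    (varResidualSum F u).toBool.size ≤ M :=
  h.residual (fun _ => le_rfl) u

/-- The three residual formulas have the same shape and differ only in the constants at their
leaves, so a single rule per node suffices. -/
theorem entails_residual_add (hU : IsUnitCost P M U) (hg : ∀ i, (g i).toBool.size ≤ 1)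
    (F : NCFormula (ZMod 2)) (hF : F.Fits M) (u v : F.Pos → ZMod 2) :
    FregeEntails P Γ (iff (residual g F (u + v)).toBool
      (.xor (residual g F u).toBool (residual g F v).toBool)) (F.size * U) := by
  induction F with
  | var i =>
    exact (hU.add_leaf (u ()) (v ()) (A := (g i).toBool)
      (by simpa using (hg i).trans hF.one_le)).mono_right (by simp [size])
  | const c => exact (hU.bit_xor_zero 0).mono_right (by simp [size])
  | add F G ihF ihG =>
    have hl := hF.add_left
    have hr := hF.add_right
    have h1 := ihF hl (u ∘ Sum.inl) (v ∘ Sum.inl)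
    have h2 := ihG hr (u ∘ Sum.inr) (v ∘ Sum.inr)
    exact (hU.xor_xor_xor (by simp [hl.residual hg, hr.residual hg]) h1 h2).mono_right
      (by simp only [size]; linarith)
  | mul F G ihF ihG =>
    have hl := hF.mul_left
    have hr := hF.mul_right
    have h1 := ihF hl (u ∘ Sum.inl) (v ∘ Sum.inl)
    have h2 := ihG hr (u ∘ Sum.inr) (v ∘ Sum.inr)
    exact (hU.and_xor_xor_xor (G := G.toBool)
      (by simp [hl.residual hg, hr.residual hg, hr.toBool]) h1 h2).mono_right
      (by simp only [size]; linarith)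

theorem entails_residual_zero (hU : IsUnitCost P M U) (hg : ∀ i, (g i).toBool.size ≤ 1)
    (F : NCFormula (ZMod 2)) (hF : F.Fits M) :
    FregeEntails P Γ (.neg (residual g F 0).toBool) ((F.size + 1) * U) := by
  have h := entails_residual_add (Γ := Γ) hU hg F hF 0 0
  rw [add_zero] at h
  exact (hU.neg_of_xor_self (by simp [hF.residual hg]) h).mono_right (by linarith)

theorem entails_residual_smul (hU : IsUnitCost P M U) (hg : ∀ i, (g i).toBool.size ≤ 1)
    (F : NCFormula (ZMod 2)) (hF : F.Fits M) (c : ZMod 2) (u : F.Pos → ZMod 2) :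
    FregeEntails P Γ (iff (residual g F (c • u)).toBool (.and (bit c) (residual g F u).toBool))
      ((F.size + 1) * U) := by
  obtain rfl | rfl : c = 0 ∨ c = 1 := by
    revert c
    decide
  · rw [zero_smul]
    have h := entails_residual_add (Γ := Γ) hU hg F hF 0 0
    rw [add_zero] at h
    exact (hU.zero_smul (by simp [hF.residual hg]) h).mono_right (by linarith)
  · rw [one_smul]
    exact (hU.one_smul (by simp [hF.residual hg])).mono_right (by nlinarith)

/-- If all leaves in the support of `u` carry the variable `xⱼ`, then this variable can be factored
out. -/
theorem entails_varResidualSum_of_label (hU : IsUnitCost P M U) (j : ℕ)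
    (F : NCFormula (ZMod 2)) (hF : F.Fits M) (u : F.Pos → ZMod 2)
    (hu : ∀ p, u p ≠ 0 → F.label p = j) :
    FregeEntails P Γ (iff (varResidualSum F u).toBool (.and (.var j) (residualSum F u).toBool))
      (F.size * U) := by
  have hj : (BoolFormula.var j).size ≤ M := hF.one_le
  induction F with
  | var i =>
    -- A leaf of weight zero may carry another variable; both sides are then false.
    by_cases h : u () = 0
    · have : FregeEntails P Γ (iff (.and (bit 0) (.var i)) (.and (.var j) (.and (bit 0) (bit 1))))
          ((var i : NCFormula (ZMod 2)).size * U) :=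
        (hU.zero_and (by simpa [toBool, BoolFormula.size] using hF.one_le)).mono_right (by simp [size])
      rw [← h] at this
      exact this
    · obtain rfl : i = j := hu () h
      exact (hU.and_comm_leaf (u ()) (by simpa [toBool, BoolFormula.size] using hF.one_le)).mono_right
        (by simp [size])
  | const c => exact (hU.and_zero (by simpa using hj)).mono_right (by simp [size])
  | add F G ihF ihG =>
    have hl := hF.add_left
    have hr := hF.add_right
    have h1 := ihF hl (u ∘ Sum.inl) fun p => hu (.inl p)
    have h2 := ihG hr (u ∘ Sum.inr) fun p => hu (.inr p)
    exact (hU.and_distrib_xor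
      (by simp [hj, hl.residualSum, hl.varResidualSum, hr.residualSum, hr.varResidualSum])
      h1 h2).mono_right (by simp only [size]; linarith)
  | mul F G ihF ihG =>
    have hl := hF.mul_left
    have hr := hF.mul_right
    have h1 := ihF hl (u ∘ Sum.inl) fun p => hu (.inl p)
    have h2 := ihG hr (u ∘ Sum.inr) fun p => hu (.inr p)
    exact (hU.and_distrib_and_xor (G := G.toBool) (by
      simp [hj, hl.residualSum, hl.varResidualSum, hr.residualSum, hr.varResidualSum, hr.toBool])
      h1 h2).mono_right (by simp only [size]; linarith)

/-- `F = c + ∑ₗ firstWeight F l * xₗ * Rₗ`. -/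
theorem entails_expansion (hU : IsUnitCost P M U) (F : NCFormula (ZMod 2)) (hF : F.Fits M)
    (hS : F.size ≤ S) :
    FregeEntails P Γ (iff F.toBool
      (.xor (bit F.constCoeff) (varResidualSum F F.firstWeight).toBool))
      (F.size * ((S + 2) * U)) := by
  induction F with
  | var i =>
    exact (hU.expand_var (by simpa [toBool, BoolFormula.size] using hF.one_le)).mono_right
      (by simp only [size]; nlinarith)
  | const c => exact (hU.bit_xor_zero c).mono_right (by simp only [size]; nlinarith)
  | add F G ihF ihG =>
    have hl := hF.add_left
    have hr := hF.add_right
    simp only [size] at hS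
    have h1 := ihF hl (by omega)
    have h2 := ihG hr (by omega)
    exact (hU.expand_xor F.constCoeff G.constCoeff
      (by simp [hl.toBool, hr.toBool, hl.varResidualSum, hr.varResidualSum])
      h1 h2).mono_right (by simp only [size]; nlinarith)
  | mul F G ihF ihG =>
    have hl := hF.mul_left
    have hr := hF.mul_right
    simp only [size] at hS
    have h1 := ihF hl (by omega)
    have h2 := ihG hr (by omega)
    have h3 : FregeEntails P Γ _ ((S + 1) * U) :=
      (entails_residual_smul (g := var) hU (fun _ => le_rfl) G hr F.constCoeff
        G.firstWeight).mono_right (Nat.mul_le_mul_right U (by omega))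
    exact (hU.expand_and F.constCoeff G.constCoeff
      (by simp [hl.toBool, hr.toBool, hl.varResidualSum, hr.varResidualSum])
      h1 h2 h3).mono_right (by simp only [size]; linarith)

/-- `∑ₗ u l * Rₗ = c + ∑ₗ nextWeight F u l * xₗ * Rₗ`. -/
theorem entails_residualSum_expansion (hU : IsUnitCost P M U) (F : NCFormula (ZMod 2))
    (hF : F.Fits M) (hS : F.size ≤ S) (u : F.Pos → ZMod 2) :
    FregeEntails P Γ (iff (residualSum F u).toBool
      (.xor (bit (residualSum F u).constCoeff) (varResidualSum F (F.nextWeight u)).toBool))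
      (F.size * ((S + 2) ^ 2 * U)) := by
  have hT : U ≤ (S + 2) ^ 2 * U := Nat.le_mul_of_pos_left U (by positivity)
  induction F with
  | var i =>
    exact (hU.expand_leaf (u ()) (A := .var i)
      (by simpa [toBool, BoolFormula.size] using hF.one_le)).mono_right (by simp only [size]; linarith)
  | const c => exact (hU.bit_xor_zero 0).mono_right (by simp only [size]; linarith)
  | add F G ihF ihG =>
    have hl := hF.add_left
    have hr := hF.add_right
    simp only [size] at hS
    have h1 := ihF hl (by omega) (u ∘ Sum.inl)
    have h2 := ihG hr (by omega) (u ∘ Sum.inr)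
    exact (hU.expand_xor _ _
      (by simp [hl.residualSum, hr.residualSum, hl.varResidualSum, hr.varResidualSum])
      h1 h2).mono_right (by simp only [size]; linarith)
  | mul F G ihF ihG =>
    have hl := hF.mul_left
    have hr := hF.mul_right
    simp only [size] at hS
    set e := (residualSum F (u ∘ Sum.inl)).constCoeff with he
    have h1 := ihF hl (by omega) (u ∘ Sum.inl)
    have h2 := ihG hr (by omega) (u ∘ Sum.inr)
    have h3 : FregeEntails P Γ _ (S * ((S + 2) * U)) :=
      (entails_expansion (S := S) hU G hr (by omega)).mono_right
        (Nat.mul_le_mul_right _ (by omega))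
    have h4 : FregeEntails P Γ _ (S * U) :=
      (entails_residual_add (g := var) hU (fun _ => le_rfl) G hr (e • G.firstWeight)
        (G.nextWeight (u ∘ Sum.inr))).mono_right (Nat.mul_le_mul_right U (by omega))
    have h5 : FregeEntails P Γ _ ((S + 1) * U) :=
      (entails_residual_smul (g := var) hU (fun _ => le_rfl) G hr e
        G.firstWeight).mono_right (Nat.mul_le_mul_right U (by omega))
    exact (hU.expand_and_xor e G.constCoeff _
      (by simp [hl.residualSum, hr.residualSum, hl.varResidualSum, hr.varResidualSum, hr.toBool])
      h1 h2 h3 h4 h5).mono_right (by simp only [size]; nlinarith)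

end NCFormula

/-! ### Refuting the echelon sequence and then the formula -/

namespace NCFormula

variable {P : Set FregeRule} {M U : ℕ}

theorem restrict_empty {K : Type} [Field K] (F : NCFormula K) (u : F.Pos → K) :
    F.restrict ∅ u = 0 := by
  ext p
  simp [restrict]

theorem restrict_insert {K : Type} [Field K] (F : NCFormula K) {j : ℕ} {S : Finset ℕ}
    (hj : j ∉ S) (u : F.Pos → K) :
    F.restrict (insert j S) u = F.restrict S u + F.restrict {j} u := by
  ext p
  simp only [restrict, Finset.mem_insert, Finset.mem_singleton, Pi.add_apply]
  by_cases h : F.label p = j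
  · simp [h, hj]
  · simp [h]

theorem restrict_vars {K : Type} [Field K] (F : NCFormula K) (u : F.Pos → K) :
    F.restrict F.vars u = u := by
  ext p
  simp [restrict, F.label_mem_vars p]

/-- The refutations of the residual sums with weights `w i`, where `k ≤ i < F.size`. -/
def refutations (F : NCFormula (ZMod 2)) (w : ℕ → F.Pos → ZMod 2) (k : ℕ) : Set BoolFormula :=
  {A | ∃ i, k ≤ i ∧ i < F.size ∧ A = .neg (residualSum F (w i)).toBool}

/-- An echelon spanning sequence, as in `exists_echelon`. -/
def IsEchelon (F : NCFormula (ZMod 2)) (w : ℕ → F.Pos → ZMod 2) : Prop :=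
  (∀ k, (residualSum F (w k)).poly = 0 ∧ F.VanishesBelow k (w k)) ∧
    ∀ k u, (residualSum F u).poly = 0 → F.VanishesBelow k u →
      F.VanishesBelow (k + 1) u ∨ F.VanishesBelow (k + 1) (u + w k)

variable {F : NCFormula (ZMod 2)} {w : ℕ → F.Pos → ZMod 2}

/-- Gaussian elimination inside the proof system: `d` counts the pivots left, and each step adds `w
k` or nothing, until the weight is zero. -/
theorem entails_neg_residualSum (hU : IsUnitCost P M U) (hF : F.Fits M) (hw : F.IsEchelon w)
    {k d : ℕ} (hk : k + d = F.size) {u : F.Pos → ZMod 2} (hu : (residualSum F u).poly = 0)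
    (hu' : F.VanishesBelow k u) :
    FregeEntails P (F.refutations w k) (.neg (residualSum F u).toBool)
      ((d + 1) * ((F.size + 1) * U)) := by
  induction d generalizing k u with
  | zero =>
    obtain rfl : k = F.size := hk
    rw [hu'.eq_zero]
    exact (entails_residual_zero hU (fun _ => le_rfl) F hF).mono_right (by linarith)
  | succ d ih =>
    have hsub : F.refutations w (k + 1) ⊆ F.refutations w k := by
      rintro A ⟨i, h1, h2, h3⟩
      exact ⟨i, by omega, h2, h3⟩
    rcases hw.2 k u hu hu' with h | h
    · exact (ih (by omega) hu h).mono hsub (Nat.mul_le_mul_right _ (by omega))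
    · have h0 : (residualSum F (u + w k)).poly = 0 := by
        rw [residualSum, poly_residual_add, hu, (hw.1 k).1, add_zero]
      have h1 := (ih (by omega) h0 h).mono hsub le_rfl
      have h2 : FregeEntails P (F.refutations w k) (.neg (residualSum F (w k)).toBool) 0 :=
        .of_mem ⟨k, le_rfl, by omega, rfl⟩
      have h3 := entails_residual_add (Γ := F.refutations w k) (g := fun _ => const 1) hU
        (fun _ => le_rfl) F hF (u + w k) (w k)
      -- In characteristic 2 this recovers `u` as (u + w k) + w k.
      rw [add_assoc, show w k + w k = 0 from funext fun p => CharTwo.add_self_eq_zero (w k p),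
        add_zero] at h3
      exact (hU.neg_of_xor (by simp [hF.residualSum]) h3 h1 h2).mono_right (by linarith)

/-- Terms are grouped by variable. Each group is x_j times a residual sum that computes zero, and
there are at most `F.size` groups. -/
theorem entails_neg_varResidualSum (hU : IsUnitCost P M U) (hF : F.Fits M) (hw : F.IsEchelon w)
    {k : ℕ} (hk : k ≤ F.size) {u : F.Pos → ZMod 2}
    (hu : ∀ j, (residualSum F (F.restrict {j} u)).poly = 0) (hu' : F.VanishesBelow k u) :
    FregeEntails P (F.refutations w k) (.neg (varResidualSum F u).toBool)
      ((F.size + 1) * ((F.size + 2) ^ 2 * U)) := by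
  suffices ∀ S : Finset ℕ, FregeEntails P (F.refutations w k)
      (.neg (varResidualSum F (F.restrict S u)).toBool)
      ((S.card + 1) * ((F.size + 2) ^ 2 * U)) by
    have h := this F.vars
    rw [restrict_vars] at h
    exact h.mono_right (Nat.mul_le_mul_right _ (Nat.succ_le_succ F.card_vars_le))
  intro S
  induction S using Finset.induction_on with
  | empty =>
    rw [restrict_empty]
    exact (entails_residual_zero hU (fun _ => le_rfl) F hF).mono_right (by
      rw [Finset.card_empty, zero_add, one_mul]
      exact Nat.mul_le_mul_right U (by nlinarith))
  | insert j S hj ih =>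
    have h1 : FregeEntails P (F.refutations w k) _ ((F.size + 1) * ((F.size + 1) * U)) :=
      (entails_neg_residualSum (d := F.size - k) hU hF hw (by omega) (hu j)
        (hu'.restrict {j})).mono_right (Nat.mul_le_mul_right _ (by omega))
    have h2 := entails_varResidualSum_of_label (Γ := F.refutations w k) hU j F hF
      (F.restrict {j} u) fun p hp => by
        by_contra h
        exact hp (by simp [restrict, h])
    have h3 := hU.neg_of_and (A := .var j) (by
      simp only [List.forall_mem_cons, List.not_mem_nil, false_imp_iff, implies_true, and_true]
      exact ⟨hF.one_le, hF.residualSum _, hF.varResidualSum _⟩) h2 h1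
    have h4 := entails_residual_add (Γ := F.refutations w k) (g := var) hU
      (fun _ => le_rfl) F hF (F.restrict S u) (F.restrict {j} u)
    rw [← restrict_insert F hj] at h4
    refine (hU.neg_of_xor (by simp [hF.varResidualSum]) h4 ih h3).mono_right ?_
    rw [Finset.card_insert_of_notMem hj]
    nlinarith

/-- The next weight of `w k` vanishes below `k + 1`, so only later members of the sequence are
needed. -/
theorem entails_neg_residualSum_echelon (hU : IsUnitCost P M U) (hF : F.Fits M)
    (hw : F.IsEchelon w) {k : ℕ} (hk : k < F.size) :
    FregeEntails P (F.refutations w (k + 1)) (.neg (residualSum F (w k)).toBool)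
      (2 * (F.size + 2) ^ 3 * U) := by
  obtain ⟨h0, hv⟩ := hw.1 k
  have h1 := entails_neg_varResidualSum hU hF hw hk (poly_residualSum_nextWeight h0) hv.nextWeight
  have h2 := entails_residualSum_expansion (Γ := F.refutations w (k + 1)) hU F hF le_rfl (w k)
  rw [constCoeff_eq_zero h0] at h2
  refine (hU.neg_of_zero_xor (by simp [hF.residualSum, hF.varResidualSum]) h2 h1).mono_right ?_
  nlinarith [Nat.zero_le (F.size ^ 2 * U), Nat.zero_le (F.size * U)]

/-- The negation of a formula that computes the zero polynomial has short proofs. -/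
theorem entails_neg_toBool (hU : IsUnitCost P M U) (hF : F.Fits M) (h : F.poly = 0) :
    FregeEntails P ∅ (.neg F.toBool) (2 * (F.size + 2) ^ 4 * U) := by
  obtain ⟨w, hw⟩ := F.exists_echelon
  have h1 : FregeEntails P (F.refutations w 0) (.neg F.toBool) (2 * (F.size + 2) ^ 3 * U) := by
    have h1 := entails_neg_varResidualSum hU hF hw (Nat.zero_le _)
      (poly_residualSum_firstWeight h) (fun _ h => absurd h (Nat.not_lt_zero _))
    have h2 := entails_expansion (Γ := F.refutations w 0) hU F hF le_rfl
    rw [constCoeff_eq_zero h] at h2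
    refine (hU.neg_of_zero_xor (by simp [hF.toBool, hF.varResidualSum]) h2 h1).mono_right ?_
    nlinarith [Nat.zero_le (F.size ^ 2 * U), Nat.zero_le (F.size * U), Nat.zero_le (F.size ^ 3 * U)]
  -- The hypotheses are discharged in increasing order of index. Each refutation is inserted by one
  -- cut and then shared by all its uses, so the costs add up instead of multiplying.
  have h2 : ∀ k ≤ F.size, FregeEntails P (F.refutations w k) (.neg F.toBool)
      ((k + 1) * (2 * (F.size + 2) ^ 3 * U)) := by
    intro k
    induction k with
    | zero => exact fun _ => h1.mono_right (by linarith)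
    | succ k ih =>
      intro hk
      refine ((entails_neg_residualSum_echelon hU hF hw hk).cut
        ((ih (by omega)).mono ?_ le_rfl)).mono_right (by linarith)
      rintro A ⟨i, hi, hi', rfl⟩
      rcases hi.eq_or_lt with rfl | hi
      · exact .inl rfl
      · exact .inr ⟨i, hi, hi', rfl⟩
  refine (h2 F.size le_rfl).mono ?_ ?_
  · rintro A ⟨i, hi, hi', -⟩
    omega
  · calc (F.size + 1) * (2 * (F.size + 2) ^ 3 * U)
        ≤ (F.size + 2) * (2 * (F.size + 2) ^ 3 * U) := Nat.mul_le_mul_right _ (by omega)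
      _ = 2 * (F.size + 2) ^ 4 * U := by ring

end NCFormula

theorem lemma5p5 (P : Set FregeRule) (hP : IsFregeSystem P) (a : ℝ) :
    ∃ C : ℝ, ∀ (s : ℕ) (F : NCFormula (ZMod 2)), 2 ≤ s → F.size ≤ s →
      (F.depth : ℝ) ≤ a * Real.logb 2 (s : ℝ) → F.poly = 0 →
        ∃ π : List BoolFormula, IsFregeProofOf P ∅ π (BoolFormula.neg F.toBool) ∧
          (fregeProofSize π : ℝ) ≤ (s : ℝ) ^ (C * Real.logb 2 (s : ℝ)) := by
  obtain ⟨c, hc⟩ := exists_isUnitCost hP.complete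
  -- As `s ≥ 2`, the constant factor 96c + 6 of the final estimate is absorbed into `s ^ k`.
  obtain ⟨k, hk⟩ := pow_unbounded_of_one_lt (96 * (c : ℝ) + 6) (one_lt_two)
  -- The summand 4 comes from the count of inference steps and 4a from 16^depth. The absolute value
  -- makes the last step, multiplying the exponent by log₂ s ≥ 1, monotone for every real `a`.
  refine ⟨|k + 4 + 4 * a|, fun s F hs hsize hdepth hpoly => ?_⟩
  set M := 3 * 16 ^ F.depth with hM
  have hFM : F.Fits M := le_rfl
  obtain ⟨π, h1, h2⟩ := (NCFormula.entails_neg_toBool (hc M hFM.one_le) hFM hpoly).exists_proof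
  refine ⟨π, h1, ?_⟩
  have hs2 : (2 : ℝ) ≤ s := by exact_mod_cast hs
  have hs0 : (0 : ℝ) < s := by linarith
  have hL : 1 ≤ Real.logb 2 s := by
    rw [Real.le_logb_iff_rpow_le one_lt_two hs0]
    simpa using hs2
  have h16 : (16 : ℝ) ^ F.depth ≤ (s : ℝ) ^ (4 * a) := by
    have h : (16 : ℝ) ^ F.depth = 2 ^ (4 * (F.depth : ℝ)) := by
      rw [Real.rpow_mul zero_le_two, Real.rpow_natCast]
      norm_num
    calc (16 : ℝ) ^ F.depth ≤ 2 ^ (Real.logb 2 s * (4 * a)) := by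
          rw [h]
          exact Real.rpow_le_rpow_of_exponent_le one_le_two (by linarith)
      _ = (s : ℝ) ^ (4 * a) := by
          rw [Real.rpow_mul zero_le_two, Real.rpow_logb two_pos (by norm_num) hs0]
  have hnat : fregeProofSize π ≤ (32 * c * s ^ 4 + 2) * M := by
    have hneg : (BoolFormula.neg F.toBool).size ≤ 2 * M := by
      have := hFM.toBool
      have := hFM.one_le
      simp only [BoolFormula.size]
      omega
    have hpow : (F.size + 2) ^ 4 ≤ (2 * s) ^ 4 := Nat.pow_le_pow_left (by omega) 4
    calc fregeProofSize π ≤ 2 * (F.size + 2) ^ 4 * (c * M) + 2 * M := h2.trans (by omega)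
      _ ≤ 2 * (2 * s) ^ 4 * (c * M) + 2 * M := by gcongr
      _ = (32 * c * s ^ 4 + 2) * M := by ring
  have hs4 : (1 : ℝ) ≤ (s : ℝ) ^ 4 := one_le_pow₀ (by linarith)
  calc (fregeProofSize π : ℝ) ≤ ((32 * c * s ^ 4 + 2) * M : ℕ) := by exact_mod_cast hnat
    _ = (32 * c * s ^ 4 + 2) * (3 * 16 ^ F.depth) := by rw [hM]; push_cast; ring
    _ ≤ (32 * c * s ^ 4 + 2 * s ^ 4) * (3 * 16 ^ F.depth) := by gcongr; linarith
    _ = (96 * c + 6) * s ^ 4 * 16 ^ F.depth := by ring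
    _ ≤ (s : ℝ) ^ k * s ^ 4 * (s : ℝ) ^ (4 * a) := by
        gcongr
        exact hk.le.trans (pow_le_pow_left₀ zero_le_two hs2 k)
    _ = (s : ℝ) ^ (k + 4 + 4 * a) := by
        rw [Real.rpow_add hs0, Real.rpow_add hs0, Real.rpow_natCast,
          show (s : ℝ) ^ (4 : ℝ) = (s : ℝ) ^ 4 from mod_cast Real.rpow_natCast (s : ℝ) 4]
    _ ≤ (s : ℝ) ^ (|k + 4 + 4 * a| * Real.logb 2 s) := by
        refine Real.rpow_le_rpow_of_exponent_le (by linarith) ((le_abs_self _).trans ?_)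
        exact le_mul_of_one_le_right (abs_nonneg _) hL
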